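/- Let $F\in\mathbb R[x]$ be a real polynomial and let $\mathbb R^3_F$ be $\mathbb R^3$ with coordinates $(x,y,z)$ and the sub-Riemannian structure given by the distribution $dz-F(x)\,dy=0$ with metric $dx^2+dy^2$. An arclength geodesic $c=(x,y,z):\mathbb R\to\mathbb R^3_F$ is the projection of a solution of Hamilton's equations for $H_F=\tfrac12p_x^2+\tfrac12(p_y+F(x)p_z)^2$ on the level $H_F=\tfrac12$. Along it $p_y=a$ and $p_z=b$ are constant, and $\dot x^2+G(x)^2=1$ for the polynomial $G=a+bF$. The geodesic is called $x$-periodic with $x$-period $L$ if $G$ is not constant, $t\mapsto x(t)$ is a non-constant periodic function, and $L>0$ is its least period. Its Hill interval is the interval $[A,B]$, $A<B$, with $G(A)^2=G(B)^2=1$ and $G^2<1$ on $(A,B)$, that contains $x(t)$ for all $t$. Its cut time is $t_{\rm cut}(c)=\sup\{t>0: c|_{[0,t]}\text{ is length-minimizing}\}$, where minimality is among all absolutely continuous horizontal curves with the same endpoints. Let $c$ be an $x$-periodic geodesic in $\mathbb R^3_F$ with $x$-period $L$. Then: 1. if $F$ is even and the Hill interval of $c$ contains $0$, then $t_{\rm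 cut}(c)\le L/2$; 2. in all cases, $t_{\rm cut}(c)\le L$. -/

import Mathlib

open Polynomial MeasureTheory

noncomputable section

namespace MagneticSpace

/-- Curves in `ℝ³` have coordinates `(x, y, z)`, indexed by `0, 1, 2`.  The distribution of
`ℝ³_F` is the kernel of `dz - F(x) dy`.  A curve is horizontal on `[a, b]` if it is absolutely
continuous there and tangent to the distribution at almost every time. -/
structure IsHorizontal (F : ℝ[X]) (c : ℝ → Fin 3 → ℝ) (a b : ℝ) : Prop where
  le : a ≤ b
  absolutelyContinuous : ∀ i, AbsolutelyContinuousOnInterval (fun t => c t i) a b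
  tangent : ∀ᵐ t ∂volume.restrict (Set.Icc a b),
    deriv (fun s => c s 2) t = F.eval (c t 0) * deriv (fun s => c s 1) t

/-- Length on `[a, b]` for the metric `dx² + dy²` on the distribution. -/
def length (c : ℝ → Fin 3 → ℝ) (a b : ℝ) : ℝ :=
  ∫ t in a..b, √((deriv (fun s => c s 0) t) ^ 2 + (deriv (fun s => c s 1) t) ^ 2)

/-- `c` restricted to `[a, b]` is a horizontal curve which is no longer than any other horizontal
curve, defined on any compact interval, with the same endpoints. -/
def IsLengthMinimizing (F : ℝ[X]) (c : ℝ → Fin 3 → ℝ) (a b : ℝ) : Prop :=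
  IsHorizontal F c a b ∧
    ∀ (γ : ℝ → Fin 3 → ℝ) (a' b' : ℝ), IsHorizontal F γ a' b' →
      γ a' = c a → γ b' = c b → length c a b ≤ length γ a' b'

/-- The cut time `sup {t > 0 : c|_[0,t] is length minimizing}`, with values in `[0, ∞]`. -/
def cutTime (F : ℝ[X]) (c : ℝ → Fin 3 → ℝ) : ENNReal :=
  ⨆ t ∈ {t : ℝ | 0 < t ∧ IsLengthMinimizing F c 0 t}, ENNReal.ofReal t

/-- The kinetic energy Hamiltonian `½ p_x² + ½ (p_y + F(x) p_z)²` on `T*ℝ³`. -/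
def hamiltonian (F : ℝ[X]) (q p : Fin 3 → ℝ) : ℝ :=
  (1 / 2) * p 0 ^ 2 + (1 / 2) * (p 1 + F.eval (q 0) * p 2) ^ 2

/-- `c` is a geodesic of `ℝ³_F`, parametrized by arclength, with momentum `p`: the pair `(c, p)`
solves Hamilton's equations on the energy level `½`. -/
structure IsGeodesic (F : ℝ[X]) (c p : ℝ → Fin 3 → ℝ) : Prop where
  velocity : ∀ t i, HasDerivAt (fun s => c s i)
    (deriv (fun v => hamiltonian F (c t) (Function.update (p t) i v)) (p t i)) t
  force : ∀ t i, HasDerivAt (fun s => p s i)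
    (-deriv (fun v => hamiltonian F (Function.update (c t) i v) (p t)) (c t i)) t
  energy : ∀ t, hamiltonian F (c t) (p t) = 1 / 2

/-- The polynomial `G = a + b F` of a geodesic, where `a = p_y` and `b = p_z` are the (constant)
second and third components of the momentum. -/
def geodesicPolynomial (F : ℝ[X]) (p : ℝ → Fin 3 → ℝ) : ℝ[X] :=
  C (p 0 1) + C (p 0 2) * F

/-- `[A, B]` is a Hill interval of `G`: `G² = 1` at both endpoints and `G² < 1` in between. -/
structure IsHillInterval (G : ℝ[X]) (A B : ℝ) : Prop where
  lt : A < B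
  left : G.eval A ^ 2 = 1
  right : G.eval B ^ 2 = 1
  interior : ∀ x ∈ Set.Ioo A B, G.eval x ^ 2 < 1

/-- `c` is an `x`-periodic geodesic with `x`-period `L`: its polynomial is not constant, and `L` is
the least positive period of its `x`-coordinate (which is therefore not constant). -/
structure IsXPeriodicGeodesic (F : ℝ[X]) (c p : ℝ → Fin 3 → ℝ) (L : ℝ) : Prop where
  geodesic : IsGeodesic F c p
  not_line : 0 < (geodesicPolynomial F p).natDegree
  period : IsLeast {T : ℝ | 0 < T ∧ Function.Periodic (fun t => c t 0) T} L

/-- `[A, B]` is the Hill interval of the geodesic `c`: the Hill interval of its polynomial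
in which the `x`-coordinate moves. -/
def IsHillIntervalOf (F : ℝ[X]) (c p : ℝ → Fin 3 → ℝ) (A B : ℝ) : Prop :=
  IsHillInterval (geodesicPolynomial F p) A B ∧ ∀ t, c t 0 ∈ Set.Icc A B

end MagneticSpace

end

/-! Suppose `F(x)` has period `τ` and `x` has period `2τ` along the geodesic, and let `s > τ` be a
time with `ẋ(s) ≠ 0`. Replace the arc of `x` on `[s - τ, s]` by the reflection in `s` of the arc on
`[s, s + τ]`, keeping `ẏ = G(x)`. The `2τ`-period makes the new path continuous, and the `τ`-period
of `F(x)` keeps the integrals of `G(x)` and `F(x)G(x)`, so endpoints and length survive. The new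
path has a corner at `s`, so it should not minimize.

The shortening is explicit. Holding `x` fixed for time `2η` around the corner saves length of order
`η`, because `|G(x(s))| < 1`, and changes the `z`-endpoint only by `O(η²)`. Adding to `ẏ` a multiple
of `F(x)` minus its mean repairs `z`, leaves `y` alone and costs `O(η²)`. Hence nothing minimizes
past `s` (`IsGeodesic.not_isLengthMinimizing`).

Transversal times `s` exist in every interval, so the cut time is at most `τ`
(`IsXPeriodicGeodesic.cutTime_le`). In general `τ = L`; for even `F` with `0` in the Hill interval,
`x(t + L/2) = -x(t)` permits `τ = L/2`. -/

namespace MagneticSpace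

/-! ### Hamilton's equations in coordinates -/

section Geodesic

variable {F : ℝ[X]} {c p : ℝ → Fin 3 → ℝ}

theorem IsGeodesic.momentum_y_eq (hc : IsGeodesic F c p) (t : ℝ) : p t 1 = p 0 1 := by
  refine is_const_of_deriv_eq_zero (f := fun s => p s 1)
    (fun t => (hc.force t 1).differentiableAt) (fun t => ?_) t 0
  rw [(hc.force t 1).deriv]
  simp [hamiltonian]

theorem IsGeodesic.momentum_z_eq (hc : IsGeodesic F c p) (t : ℝ) : p t 2 = p 0 2 := by
  refine is_const_of_deriv_eq_zero (f := fun s => p s 2)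
    (fun t => (hc.force t 2).differentiableAt) (fun t => ?_) t 0
  rw [(hc.force t 2).deriv]
  simp [hamiltonian]

theorem IsGeodesic.eval_geodesicPolynomial (hc : IsGeodesic F c p) (t x : ℝ) :
    (geodesicPolynomial F p).eval x = p t 1 + F.eval x * p t 2 := by
  simp [geodesicPolynomial, hc.momentum_y_eq t, hc.momentum_z_eq t, mul_comm]

theorem IsGeodesic.hasDerivAt_x (hc : IsGeodesic F c p) (t : ℝ) :
    HasDerivAt (fun s => c s 0) (p t 0) t := by
  refine (hc.velocity t 0).congr_deriv (HasDerivAt.deriv ?_)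
  simp only [hamiltonian, Function.update_self, ne_eq, Fin.reduceEq, not_false_eq_true,
    Function.update_of_ne]
  refine ((((hasDerivAt_id (p t 0)).pow 2).const_mul (1 / 2)).add_const _).congr_deriv ?_
  simp

theorem IsGeodesic.hasDerivAt_y (hc : IsGeodesic F c p) (t : ℝ) :
    HasDerivAt (fun s => c s 1) ((geodesicPolynomial F p).eval (c t 0)) t := by
  refine (hc.velocity t 1).congr_deriv (HasDerivAt.deriv ?_)
  rw [hc.eval_geodesicPolynomial t]
  simp only [hamiltonian, Function.update_self, ne_eq, Fin.reduceEq, not_false_eq_true,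
    Function.update_of_ne]
  refine (((((hasDerivAt_id (p t 1)).add_const _).pow 2).const_mul (1 / 2)).const_add
    _).congr_deriv ?_
  simp

theorem IsGeodesic.hasDerivAt_z (hc : IsGeodesic F c p) (t : ℝ) :
    HasDerivAt (fun s => c s 2)
      (F.eval (c t 0) * (geodesicPolynomial F p).eval (c t 0)) t := by
  refine (hc.velocity t 2).congr_deriv (HasDerivAt.deriv ?_)
  rw [hc.eval_geodesicPolynomial t]
  simp only [hamiltonian, Function.update_self, ne_eq, Fin.reduceEq, not_false_eq_true,
    Function.update_of_ne]
  refine ((((((hasDerivAt_id (p t 2)).const_mul (F.eval (c t 0))).const_add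
    (p t 1)).pow 2).const_mul (1 / 2)).const_add _).congr_deriv ?_
  simp
  ring

theorem IsGeodesic.hasDerivAt_momentum_x (hc : IsGeodesic F c p) (t : ℝ) :
    HasDerivAt (fun s => p s 0)
      ((-(geodesicPolynomial F p * derivative (geodesicPolynomial F p))).eval (c t 0)) t := by
  refine (hc.force t 0).congr_deriv ?_
  rw [eval_neg, eval_mul, hc.eval_geodesicPolynomial t, neg_inj]
  refine HasDerivAt.deriv ?_
  simp only [hamiltonian, Function.update_self]
  refine ((((((F.hasDerivAt (c t 0)).mul_const (p t 2)).const_add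
    (p t 1)).pow 2).const_mul (1 / 2)).const_add _).congr_deriv ?_
  simp [geodesicPolynomial, hc.momentum_z_eq t]
  ring

theorem IsGeodesic.sq_add_sq (hc : IsGeodesic F c p) (t : ℝ) :
    p t 0 ^ 2 + (geodesicPolynomial F p).eval (c t 0) ^ 2 = 1 := by
  have h := hc.energy t
  rw [hamiltonian] at h
  rw [hc.eval_geodesicPolynomial t]
  linarith

theorem IsGeodesic.continuous_x (hc : IsGeodesic F c p) : Continuous fun t => c t 0 :=
  continuous_iff_continuousAt.2 fun t => (hc.hasDerivAt_x t).continuousAt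

theorem IsGeodesic.length_eq (hc : IsGeodesic F c p) (a b : ℝ) : length c a b = b - a := by
  have h : ∀ t, √((deriv (fun s => c s 0) t) ^ 2 + (deriv (fun s => c s 1) t) ^ 2) = 1 :=
    fun t => by
      rw [(hc.hasDerivAt_x t).deriv, (hc.hasDerivAt_y t).deriv, hc.sq_add_sq, Real.sqrt_one]
  simp [length, h]

theorem IsGeodesic.lipschitzWith_x (hc : IsGeodesic F c p) :
    LipschitzWith 1 fun t => c t 0 := by
  refine lipschitzWith_of_nnnorm_deriv_le (fun t => (hc.hasDerivAt_x t).differentiableAt)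
    fun t => ?_
  rw [(hc.hasDerivAt_x t).deriv, ← NNReal.coe_le_coe]
  simp only [coe_nnnorm, Real.norm_eq_abs, NNReal.coe_one]
  rw [← sq_le_one_iff_abs_le_one]
  linarith [hc.sq_add_sq t, sq_nonneg ((geodesicPolynomial F p).eval (c t 0))]

end Geodesic

/-! ### Uniqueness for bounded solutions -/

section Uniqueness

/-- Bounded solutions of an autonomous `C¹` differential equation are determined by their value at
one time. -/
theorem eq_of_hasDerivAt_of_isBounded {E : Type*} [NormedAddCommGroup E] [NormedSpace ℝ E]
    [ProperSpace E] {v : E → E} (hv : ContDiff ℝ 1 v) {f g : ℝ → E}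
    (hf : ∀ t, HasDerivAt f (v (f t)) t) (hg : ∀ t, HasDerivAt g (v (g t)) t)
    (hfb : Bornology.IsBounded (Set.range f)) (hgb : Bornology.IsBounded (Set.range g))
    {t₀ : ℝ} (h : f t₀ = g t₀) : f = g := by
  -- A `C¹` field need not be globally Lipschitz, but it is Lipschitz on a closed ball containing
  -- both orbits.
  obtain ⟨R, hR⟩ := (hfb.union hgb).subset_closedBall 0
  obtain ⟨K, hK⟩ := hv.contDiffOn.exists_lipschitzOnWith one_ne_zero
    (convex_closedBall (0 : E) R) (isCompact_closedBall 0 R)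
  exact ODE_solution_unique_univ (v := fun _ => v) (s := fun _ => Metric.closedBall 0 R)
    (fun _ => hK) (fun t => ⟨hf t, hR (Or.inl ⟨t, rfl⟩)⟩) (fun t => ⟨hg t, hR (Or.inr ⟨t, rfl⟩)⟩) h

/-- Bounded solutions of Newton's equation `x'' = V(x)` with a polynomial force are determined by
their position and velocity at one time. -/
theorem eq_of_newton {V : ℝ[X]} {x₁ v₁ x₂ v₂ : ℝ → ℝ}
    (hx₁ : ∀ t, HasDerivAt x₁ (v₁ t) t) (hv₁ : ∀ t, HasDerivAt v₁ (V.eval (x₁ t)) t)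
    (hx₂ : ∀ t, HasDerivAt x₂ (v₂ t) t) (hv₂ : ∀ t, HasDerivAt v₂ (V.eval (x₂ t)) t)
    (hbx₁ : Bornology.IsBounded (Set.range x₁)) (hbv₁ : Bornology.IsBounded (Set.range v₁))
    (hbx₂ : Bornology.IsBounded (Set.range x₂)) (hbv₂ : Bornology.IsBounded (Set.range v₂))
    {t₀ : ℝ} (hx : x₁ t₀ = x₂ t₀) (hv : v₁ t₀ = v₂ t₀) : x₁ = x₂ := by
  have hC : ContDiff ℝ 1 fun q : ℝ × ℝ => (q.2, V.eval q.1) :=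
    contDiff_snd.prodMk ((V.contDiff_aeval 1).comp contDiff_fst)
  have key := eq_of_hasDerivAt_of_isBounded hC (f := fun t => (x₁ t, v₁ t))
    (g := fun t => (x₂ t, v₂ t)) (fun t => (hx₁ t).prodMk (hv₁ t))
    (fun t => (hx₂ t).prodMk (hv₂ t))
    ((hbx₁.prod hbv₁).subset (by rintro _ ⟨t, rfl⟩; exact ⟨⟨t, rfl⟩, t, rfl⟩))
    ((hbx₂.prod hbv₂).subset (by rintro _ ⟨t, rfl⟩; exact ⟨⟨t, rfl⟩, t, rfl⟩))
    (t₀ := t₀) (Prod.ext hx hv)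
  exact funext fun t => congrArg Prod.fst (congrFun key t)

end Uniqueness

/-- Every period is an integer multiple of the least positive one. -/
theorem exists_int_mul_eq_of_periodic {α : Type*} {f : ℝ → α} {L T : ℝ}
    (hL : IsLeast {T : ℝ | 0 < T ∧ Function.Periodic f T} L) (hT : Function.Periodic f T) :
    ∃ n : ℤ, T = n * L := by
  have hL0 : 0 < L := hL.1.1
  refine ⟨⌊T / L⌋, ?_⟩
  by_contra hne
  have h1 : (⌊T / L⌋ : ℝ) * L ≤ T := (le_div_iff₀ hL0).1 (Int.floor_le _)
  have h2 : T < (⌊T / L⌋ + 1) * L := (div_lt_iff₀ hL0).1 (Int.lt_floor_add_one _)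
  -- The remainder of `T` modulo `L` would be a positive period smaller than `L`.
  have h3 : 0 < T - ⌊T / L⌋ * L := sub_pos.2 (lt_of_le_of_ne h1 (Ne.symm hne))
  have h4 := hL.2 ⟨h3, hT.sub_period (hL.1.2.int_mul _)⟩
  linarith

/-! ### Turning points and symmetry of the `x`-motion -/

section XPeriodic

variable {F : ℝ[X]} {c p : ℝ → Fin 3 → ℝ} {L : ℝ}

theorem IsXPeriodicGeodesic.pos (hc : IsXPeriodicGeodesic F c p L) : 0 < L := hc.period.1.1

theorem IsXPeriodicGeodesic.periodic (hc : IsXPeriodicGeodesic F c p L) :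
    Function.Periodic (fun t => c t 0) L := hc.period.1.2

theorem IsXPeriodicGeodesic.exists_ne (hc : IsXPeriodicGeodesic F c p L) (x₀ : ℝ) :
    ∃ t, c t 0 ≠ x₀ := by
  by_contra! h
  have h1 : L ≤ L / 2 := hc.period.2 ⟨half_pos hc.pos, fun t => by simp [h]⟩
  linarith [hc.pos]

theorem IsXPeriodicGeodesic.isBounded_x (hc : IsXPeriodicGeodesic F c p L) :
    Bornology.IsBounded (Set.range fun t => c t 0) :=
  hc.periodic.isBounded_of_continuous hc.pos.ne' hc.geodesic.continuous_x

theorem IsGeodesic.isBounded_momentum_x (hc : IsGeodesic F c p) :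
    Bornology.IsBounded (Set.range fun t => p t 0) := by
  refine (Metric.isBounded_Icc (-1 : ℝ) 1).subset ?_
  rintro _ ⟨t, rfl⟩
  refine abs_le.1 ((sq_le_one_iff_abs_le_one _).1 ?_)
  linarith [hc.sq_add_sq t, sq_nonneg ((geodesicPolynomial F p).eval (c t 0))]

theorem IsXPeriodicGeodesic.eq_of_newton (hc : IsXPeriodicGeodesic F c p L) {x v : ℝ → ℝ}
    (hx : ∀ t, HasDerivAt x (v t) t)
    (hv : ∀ t, HasDerivAt v
      ((-(geodesicPolynomial F p * derivative (geodesicPolynomial F p))).eval (x t)) t)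
    (hbx : Bornology.IsBounded (Set.range x)) (hbv : Bornology.IsBounded (Set.range v))
    {t₀ : ℝ} (hx₀ : x t₀ = c t₀ 0) (hv₀ : v t₀ = p t₀ 0) (t : ℝ) : x t = c t 0 :=
  congrFun (MagneticSpace.eq_of_newton hx hv hc.geodesic.hasDerivAt_x
    hc.geodesic.hasDerivAt_momentum_x hbx hbv hc.isBounded_x hc.geodesic.isBounded_momentum_x
    hx₀ hv₀) t

/-- The `x`-coordinate of an `x`-periodic geodesic never rests at an equilibrium. -/
theorem IsXPeriodicGeodesic.force_ne_zero (hc : IsXPeriodicGeodesic F c p L) {t : ℝ}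
    (ht : p t 0 = 0) :
    (-(geodesicPolynomial F p * derivative (geodesicPolynomial F p))).eval (c t 0) ≠ 0 := by
  intro h
  obtain ⟨s, hs⟩ := hc.exists_ne (c t 0)
  -- The constant path at a force-free rest point solves the same equation, so `x` would be
  -- constant.
  refine hs (hc.eq_of_newton (x := fun _ => c t 0) (v := fun _ => 0) (t₀ := t)
    (fun _ => hasDerivAt_const _ _) (fun r => ?_) ?_ ?_ rfl ht.symm s).symm
  · rw [h]
    exact hasDerivAt_const _ _
  · exact (Set.finite_range_const).isBounded
  · exact (Set.finite_range_const).isBounded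

/-- Supplies the transversal fold time: if `p_x` vanished on an interval, so would its derivative,
the force, at a rest point. -/
theorem IsXPeriodicGeodesic.exists_momentum_x_ne_zero (hc : IsXPeriodicGeodesic F c p L)
    {a b : ℝ} (hab : a < b) : ∃ s ∈ Set.Ioo a b, p s 0 ≠ 0 := by
  by_contra! h
  obtain ⟨s, hs⟩ := exists_between hab
  refine hc.force_ne_zero (h s hs) ((hc.geodesic.hasDerivAt_momentum_x s).unique ?_)
  refine (hasDerivAt_const s (0 : ℝ)).congr_of_eventuallyEq ?_
  filter_upwards [Ioo_mem_nhds hs.1 hs.2] with r hr using h r hr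

theorem IsHillInterval.eq_or_eq {G : ℝ[X]} {A B x : ℝ} (h : IsHillInterval G A B)
    (hx : x ∈ Set.Icc A B) (hG : G.eval x ^ 2 = 1) : x = A ∨ x = B := by
  by_contra! hne
  exact (h.interior x ⟨lt_of_le_of_ne hx.1 hne.1.symm, lt_of_le_of_ne hx.2 hne.2⟩).ne hG

/-- The `x`-coordinate reaches both endpoints of its Hill interval. -/
theorem IsXPeriodicGeodesic.exists_eq_endpoints (hc : IsXPeriodicGeodesic F c p L) {A B : ℝ}
    (h : IsHillIntervalOf F c p A B) :
    (∃ t, c t 0 = A ∧ p t 0 = 0) ∧ ∃ t, c t 0 = B ∧ p t 0 = 0 := by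
  have hcomp : IsCompact (Set.range fun t => c t 0) :=
    hc.periodic.compact_of_continuous hc.pos.ne' hc.geodesic.continuous_x
  obtain ⟨_, ⟨t₁, rfl⟩, h₁⟩ := hcomp.exists_isLeast (Set.range_nonempty _)
  obtain ⟨_, ⟨t₂, rfl⟩, h₂⟩ := hcomp.exists_isGreatest (Set.range_nonempty _)
  -- At the extrema of `x` the velocity vanishes, so `G² = 1` there and they are endpoints of the
  -- Hill interval; minimum below maximum decides which.
  have hp₁ : p t₁ 0 = 0 := IsLocalMin.hasDerivAt_eq_zero (f := fun t => c t 0)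
    (Filter.Eventually.of_forall fun t => h₁ ⟨t, rfl⟩) (hc.geodesic.hasDerivAt_x t₁)
  have hp₂ : p t₂ 0 = 0 := IsLocalMax.hasDerivAt_eq_zero (f := fun t => c t 0)
    (Filter.Eventually.of_forall fun t => h₂ ⟨t, rfl⟩) (hc.geodesic.hasDerivAt_x t₂)
  have hend : ∀ t, p t 0 = 0 → c t 0 = A ∨ c t 0 = B := fun t ht =>
    h.1.eq_or_eq (h.2 t) (by simpa [ht] using hc.geodesic.sq_add_sq t)
  have hlt : c t₁ 0 < c t₂ 0 := by
    obtain ⟨s, hs⟩ := hc.exists_ne (c t₁ 0)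
    exact lt_of_lt_of_le (lt_of_le_of_ne (h₁ ⟨s, rfl⟩) hs.symm) (h₂ ⟨s, rfl⟩)
  have hAB := h.1.lt
  refine ⟨⟨t₁, ?_, hp₁⟩, t₂, ?_, hp₂⟩
  · rcases hend t₁ hp₁ with h' | h'
    · exact h'
    · linarith [(h.2 t₂).2]
  · rcases hend t₂ hp₂ with h' | h'
    · linarith [(h.2 t₁).1]
    · exact h'

/-- If `F` is even and the Hill interval contains `0`, then half a period reflects `x`. -/
theorem IsXPeriodicGeodesic.antiperiodic_half (hc : IsXPeriodicGeodesic F c p L) {A B : ℝ}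
    (h : IsHillIntervalOf F c p A B) (hF : ∀ x : ℝ, F.eval (-x) = F.eval x)
    (h0 : (0 : ℝ) ∈ Set.Icc A B) : Function.Antiperiodic (fun t => c t 0) (L / 2) := by
  set G := geodesicPolynomial F p with hG
  have hAB := h.1.lt
  have hGe : ∀ x, G.eval (-x) = G.eval x := fun x => by simp [hG, geodesicPolynomial, hF]
  have hGo : ∀ x, (derivative G).eval (-x) = -(derivative G).eval x := fun x => by
    have h1 : HasDerivAt (fun y : ℝ => G.eval (-y)) ((derivative G).eval (-x) * -1) x :=
      (G.hasDerivAt (-x)).comp x (hasDerivAt_neg x)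
    simp only [hGe] at h1
    linarith [h1.unique (G.hasDerivAt x)]
  have hVo : ∀ x, (-(G * derivative G)).eval (-x) = -(-(G * derivative G)).eval x := fun x => by
    simp [hGe, hGo]
  obtain ⟨⟨t₁, hx₁, hp₁⟩, t₂, hx₂, hp₂⟩ := hc.exists_eq_endpoints h
  have hV0 : (-(G * derivative G)).eval 0 = 0 := by
    have := hVo 0
    rw [neg_zero] at this
    linarith
  -- The force is odd and vanishes at `0`, whereas turning points carry nonzero force.
  have hA : A ≠ 0 := fun hA => hc.force_ne_zero hp₁ (by rw [hx₁, hA]; exact hV0)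
  have hB : B ≠ 0 := fun hB => hc.force_ne_zero hp₂ (by rw [hx₂, hB]; exact hV0)
  have hA0 : A < 0 := lt_of_le_of_ne h0.1 hA
  have hB0 : 0 < B := lt_of_le_of_ne h0.2 hB.symm
  -- By evenness `G² = 1` also at `-A` and `-B`, so neither lies in the open Hill interval; this
  -- forces `B = -A`.
  have hle₁ : B ≤ -A := by
    by_contra! hlt
    exact (h.1.interior (-A) ⟨by linarith, hlt⟩).ne (by rw [hGe]; exact h.1.left)
  have hle₂ : -A ≤ B := by
    by_contra! hlt
    exact (h.1.interior (-B) ⟨by linarith, by linarith⟩).ne (by rw [hGe]; exact h.1.right)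
  -- Since the force is odd, the shifted and reflected path solves the same equation; at `t₁` both
  -- paths are at rest at `A = -B`.
  have hrefl : ∀ t, -c (t + (t₂ - t₁)) 0 = c t 0 := by
    refine hc.eq_of_newton (x := fun t => -c (t + (t₂ - t₁)) 0)
      (v := fun t => -p (t + (t₂ - t₁)) 0) (t₀ := t₁) (fun t => ?_) (fun t => ?_) ?_ ?_ ?_ ?_
    · exact ((hc.geodesic.hasDerivAt_x (t + (t₂ - t₁))).comp_add_const t _).neg
    · rw [← hG, hVo]
      exact ((hc.geodesic.hasDerivAt_momentum_x (t + (t₂ - t₁))).comp_add_const t _).neg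
    · refine hc.isBounded_x.neg.subset ?_
      rintro _ ⟨t, rfl⟩
      exact ⟨t + (t₂ - t₁), by simp⟩
    · refine hc.geodesic.isBounded_momentum_x.neg.subset ?_
      rintro _ ⟨t, rfl⟩
      exact ⟨t + (t₂ - t₁), by simp⟩
    · rw [add_sub_cancel, hx₁, hx₂]
      linarith
    · rw [add_sub_cancel, hp₁, hp₂, neg_zero]
  have hanti : Function.Antiperiodic (fun t => c t 0) (t₂ - t₁) := fun t => by
    simp only [← hrefl t, neg_neg]
  obtain ⟨n, hn⟩ := exists_int_mul_eq_of_periodic hc.period (hanti.periodic_two_mul)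
  -- If `n` were even, `t₂ - t₁` would be both a period and an antiperiod, forcing `x = 0`. For odd
  -- `n`, it differs from `L / 2` by a multiple of `L`.
  rcases Int.even_or_odd' n with ⟨k, rfl | rfl⟩
  · have hk : t₂ - t₁ = k * L := by
      push_cast at hn
      linarith
    obtain ⟨s, hs⟩ := hc.exists_ne 0
    have h1 := hanti s
    have h2 := hc.periodic.int_mul k s
    rw [hk] at h1
    exact absurd (by linarith : c s 0 = 0) hs
  · have hk : L / 2 = (t₂ - t₁) - k * L := by
      push_cast at hn
      linarith
    rw [hk]
    intro t
    have h2 := hc.periodic.int_mul k (t + (t₂ - t₁ - k * L))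
    have h1 := hanti t
    simp only at h1 h2 ⊢
    rw [← h2, ← h1, add_assoc, sub_add_cancel]

end XPeriodic

/-! ### Integral bounds on a short time window -/

section Integrals

theorem integral_indicator_Icc_const {T a b K : ℝ} (ha : 0 < a) (hab : a ≤ b) (hb : b ≤ T) :
    ∫ r in (0 : ℝ)..T, (Set.Icc a b).indicator (fun _ => K) r = K * (b - a) := by
  rw [intervalIntegral.integral_of_le (by linarith), setIntegral_indicator measurableSet_Icc,
    Set.inter_eq_right.2 (show Set.Icc a b ⊆ Set.Ioc 0 T from
      fun r hr => ⟨ha.trans_le hr.1, hr.2.trans hb⟩), setIntegral_const,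
    Real.volume_real_Icc_of_le hab, smul_eq_mul, mul_comm]

theorem intervalIntegrable_indicator_Icc_const (T a b K : ℝ) :
    IntervalIntegrable ((Set.Icc a b).indicator fun _ => K) volume 0 T :=
  ⟨integrableOn_const (by simp) |>.indicator measurableSet_Icc,
    integrableOn_const (by simp) |>.indicator measurableSet_Icc⟩

/-- The integral of a function which is bounded by `K` and supported in `[a, b]`. -/
theorem abs_integral_le_of_support {T a b K : ℝ} (ha : 0 < a) (hab : a ≤ b) (hb : b ≤ T)
    {h : ℝ → ℝ} (hK : ∀ r ∈ Set.Icc a b, |h r| ≤ K) (h0 : ∀ r, r ∉ Set.Icc a b → h r = 0) :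
    |∫ r in (0 : ℝ)..T, h r| ≤ K * (b - a) := by
  rw [← integral_indicator_Icc_const ha hab hb, ← Real.norm_eq_abs]
  refine intervalIntegral.norm_integral_le_of_norm_le (by linarith)
    (Filter.Eventually.of_forall fun r _ => ?_) (intervalIntegrable_indicator_Icc_const T a b K)
  by_cases hr : r ∈ Set.Icc a b
  · simpa [hr] using hK r hr
  · simp [hr, h0 r hr]

/-- The integral of a nonnegative function which is at most `K` and drops by `k` on `[a, b]`. -/
theorem integral_le_of_drop {T a b K k : ℝ} (ha : 0 < a) (hab : a ≤ b) (hb : b ≤ T)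
    {h : ℝ → ℝ} (h0 : ∀ r, 0 ≤ h r)
    (hK : ∀ᵐ r, h r ≤ K - (Set.Icc a b).indicator (fun _ => k) r) :
    ∫ r in (0 : ℝ)..T, h r ≤ K * T - k * (b - a) := by
  have hi := intervalIntegrable_indicator_Icc_const T a b k
  have hc : IntervalIntegrable (fun _ : ℝ => K) volume 0 T := intervalIntegrable_const
  have hT : (0 : ℝ) ≤ T := by linarith
  have hval : ∫ r in (0 : ℝ)..T, (K - (Set.Icc a b).indicator (fun _ => k) r)
      = K * T - k * (b - a) := by
    rw [intervalIntegral.integral_sub hc hi, integral_indicator_Icc_const ha hab hb]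
    simp [mul_comm]
  rw [← hval, intervalIntegral.integral_of_le hT, intervalIntegral.integral_of_le hT]
  exact integral_mono_of_nonneg (Filter.Eventually.of_forall h0)
    ((intervalIntegrable_iff_integrableOn_Ioc_of_le hT).1 (hc.sub hi)) (ae_restrict_of_ae hK)

end Integrals

/-! ### Folding a path and cutting its corner -/

section Fold

/-- The path `x`, with the arc between `ε` and `s` replaced by the reflection in `s` of the arc
after `s`, and with the corner at `s` cut off at distance `η`. -/
def foldedPath (x : ℝ → ℝ) (ε s η r : ℝ) : ℝ :=
  x (min r ε) + x (s + max |max r ε - s| η) - x ε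

variable {x : ℝ → ℝ} {ε s η r : ℝ}

/-- The gluing condition `x (2 * s - ε) = x ε` cancels the two frozen terms of `foldedPath`. -/
theorem foldedPath_of_le (hη : η ≤ s - ε) (hεs : ε ≤ s) (hx : x (2 * s - ε) = x ε) (hr : r ≤ ε) :
    foldedPath x ε s η r = x r := by
  have h : s + max |ε - s| η = 2 * s - ε := by
    rw [abs_of_nonpos (by linarith), max_eq_left (by linarith)]
    ring
  rw [foldedPath, min_eq_left hr, max_eq_right hr, h, hx, add_sub_cancel_right]

theorem foldedPath_of_ge (hr : ε ≤ r) : foldedPath x ε s η r = x (s + max |r - s| η) := by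
  rw [foldedPath, min_eq_right hr, max_eq_left hr, add_sub_cancel_left]

theorem foldedPath_reflect (hr : ε ≤ r) (hr' : r ≤ s - η) (hη : 0 ≤ η) :
    foldedPath x ε s η r = x (2 * s - r) := by
  rw [foldedPath_of_ge hr, abs_of_nonpos (by linarith), max_eq_left (by linarith)]
  congr 1
  ring

theorem foldedPath_corner (hr : ε ≤ r) (hr' : |r - s| ≤ η) :
    foldedPath x ε s η r = x (s + η) := by
  rw [foldedPath_of_ge hr, max_eq_right hr']

theorem foldedPath_after (hεs : ε ≤ s) (hr : s + η ≤ r) (hη : 0 ≤ η) :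
    foldedPath x ε s η r = x r := by
  rw [foldedPath_of_ge (by linarith), abs_of_nonneg (by linarith), max_eq_left (by linarith),
    add_sub_cancel]

theorem foldedPath_eq_of_notMem (hη : 0 ≤ η) (hηε : η ≤ s - ε) (hr : r ∉ Set.Icc (s - η) (s + η)) :
    foldedPath x ε s η r = foldedPath x ε s 0 r := by
  rcases le_total r ε with h | h
  · have h1 : |ε - s| = s - ε := by rw [abs_of_nonpos (by linarith), neg_sub]
    rw [foldedPath, foldedPath, max_eq_right h, h1, max_eq_left hηε, max_eq_left (by linarith)]
  · have h1 : η ≤ |r - s| := by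
      by_contra! hlt
      exact hr ⟨by linarith [(abs_lt.1 hlt).1], by linarith [(abs_lt.1 hlt).2]⟩
    rw [foldedPath_of_ge h, foldedPath_of_ge h, max_eq_left h1, max_eq_left (abs_nonneg _)]

/-- The constant 2 comes from adding two 1-Lipschitz terms. It serves only continuity and absolute
continuity; the sharp speed comes from `exists_hasDerivAt_foldedPath`. -/
theorem lipschitzWith_foldedPath (hx : LipschitzWith 1 x) (ε s η : ℝ) :
    LipschitzWith 2 (foldedPath x ε s η) := by
  refine LipschitzWith.of_dist_le_mul fun r r' => ?_
  have h1 := hx.dist_le_mul (min r ε) (min r' ε)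
  have h2 := hx.dist_le_mul (s + max |max r ε - s| η) (s + max |max r' ε - s| η)
  simp only [Real.dist_eq, NNReal.coe_one, one_mul, NNReal.coe_ofNat] at h1 h2 ⊢
  have h3 : |min r ε - min r' ε| ≤ |r - r'| := by
    simpa using abs_min_sub_min_le_max r ε r' ε
  have h4 : |max |max r ε - s| η - max |max r' ε - s| η| ≤ |r - r'| :=
    (abs_max_sub_max_le_abs _ _ _).trans ((abs_abs_sub_abs_le_abs_sub _ _).trans (by
      rw [sub_sub_sub_cancel_right]
      exact abs_max_sub_max_le_abs _ _ _))
  rw [add_sub_add_left_eq_sub] at h2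
  have h5 : foldedPath x ε s η r - foldedPath x ε s η r' = (x (min r ε) - x (min r' ε)) +
      (x (s + max |max r ε - s| η) - x (s + max |max r' ε - s| η)) := by
    simp only [foldedPath]
    ring
  rw [h5]
  linarith [abs_add_le (x (min r ε) - x (min r' ε))
    (x (s + max |max r ε - s| η) - x (s + max |max r' ε - s| η))]

theorem foldedPath_zero_mem_range (hεs : ε ≤ s) (hx : x (2 * s - ε) = x ε) (r : ℝ) :
    ∃ u, foldedPath x ε s 0 r = x u := by
  rcases le_total r ε with h | h
  · exact ⟨r, foldedPath_of_le (by linarith) hεs hx h⟩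
  · exact ⟨_, foldedPath_of_ge h⟩

/-- Away from finitely many times, the folded path has at most the speed of `x`, and it rests
where the corner has been cut off. -/
theorem exists_hasDerivAt_foldedPath {v : ℝ → ℝ} (hxv : ∀ t, HasDerivAt x (v t) t)
    (hη : 0 < η) (hηε : η < s - ε) (hx : x (2 * s - ε) = x ε)
    (h1 : r ≠ ε) (h2 : r ≠ s - η) (h3 : r ≠ s + η) :
    (r ∈ Set.Icc (s - η) (s + η) ∧ HasDerivAt (foldedPath x ε s η) 0 r) ∨
      (r ∉ Set.Icc (s - η) (s + η) ∧ ∃ u, foldedPath x ε s 0 r = x u ∧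
        (HasDerivAt (foldedPath x ε s η) (v u) r ∨
          HasDerivAt (foldedPath x ε s η) (-v u) r)) := by
  rcases lt_or_gt_of_ne h1 with hr | hr
  · refine Or.inr ⟨fun h => by linarith [h.1], r,
      foldedPath_of_le (by linarith) (by linarith) hx hr.le, Or.inl ?_⟩
    refine (hxv r).congr_of_eventuallyEq ?_
    filter_upwards [Iio_mem_nhds hr] with t ht
    exact foldedPath_of_le hηε.le (by linarith) hx (le_of_lt ht)
  rcases lt_or_gt_of_ne h2 with hr2 | hr2
  · refine Or.inr ⟨fun h => by linarith [h.1], 2 * s - r,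
      foldedPath_reflect hr.le (by linarith) le_rfl, Or.inr ?_⟩
    refine ((hxv (2 * s - r)).comp_const_sub (2 * s) r).congr_of_eventuallyEq ?_
    filter_upwards [Ioo_mem_nhds hr hr2] with t ht
    exact foldedPath_reflect ht.1.le ht.2.le hη.le
  rcases lt_or_gt_of_ne h3 with hr3 | hr3
  · refine Or.inl ⟨⟨hr2.le, hr3.le⟩, (hasDerivAt_const r (x (s + η))).congr_of_eventuallyEq ?_⟩
    filter_upwards [Ioo_mem_nhds hr2 hr3] with t ht
    exact foldedPath_corner (by linarith [ht.1])
      (abs_le.2 ⟨by linarith [ht.1], by linarith [ht.2]⟩)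
  · refine Or.inr ⟨fun h => by linarith [h.2], r,
      foldedPath_after (by linarith) (by linarith) le_rfl, Or.inl ?_⟩
    refine (hxv r).congr_of_eventuallyEq ?_
    filter_upwards [Ioi_mem_nhds hr3] with t ht
    exact foldedPath_after (by linarith) (le_of_lt ht) hη.le

/-- Folding does not change the integral of a function of `x` with period `s - ε`. -/
theorem integral_foldedPath_zero {h : ℝ → ℝ} (hh : Continuous h) (hX : LipschitzWith 1 x)
    (hεs : ε ≤ s) (hx : x (2 * s - ε) = x ε)
    (hper : Function.Periodic (fun t => h (x t)) (s - ε))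
    (hε : 0 ≤ ε) {T : ℝ} (hT : s ≤ T) :
    ∫ r in (0 : ℝ)..T, h (foldedPath x ε s 0 r) = ∫ r in (0 : ℝ)..T, h (x r) := by
  have hi : ∀ a b, IntervalIntegrable (fun r => h (foldedPath x ε s 0 r)) volume a b :=
    (hh.comp (lipschitzWith_foldedPath hX ε s 0).continuous).intervalIntegrable
  have hj : ∀ a b, IntervalIntegrable (fun r => h (x r)) volume a b :=
    (hh.comp hX.continuous).intervalIntegrable
  rw [← intervalIntegral.integral_add_adjacent_intervals (hi 0 s) (hi s T),
    ← intervalIntegral.integral_add_adjacent_intervals (hi 0 ε) (hi ε s),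
    ← intervalIntegral.integral_add_adjacent_intervals (hj 0 s) (hj s T),
    ← intervalIntegral.integral_add_adjacent_intervals (hj 0 ε) (hj ε s)]
  congr 1
  · congr 1
    · refine intervalIntegral.integral_congr fun r hr => ?_
      rw [Set.uIcc_of_le hε] at hr
      rw [foldedPath_of_le (by linarith) hεs hx hr.2]
    · have h1 : ∫ r in ε..s, h (foldedPath x ε s 0 r) = ∫ r in ε..s, h (x (2 * s - r)) := by
        refine intervalIntegral.integral_congr fun r hr => ?_
        rw [Set.uIcc_of_le hεs] at hr
        rw [foldedPath_reflect hr.1 (by linarith [hr.2]) le_rfl]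
      -- The reflection carries `[ε, s]` to `[s, 2 * s - ε]`; both are full periods of `h ∘ x`.
      have h2 := hper.intervalIntegral_add_eq s ε
      rw [h1, intervalIntegral.integral_comp_sub_left (fun r => h (x r)) (2 * s)]
      rw [add_sub_cancel] at h2
      rw [← h2]
      congr 1 <;> ring
  · refine intervalIntegral.integral_congr fun r hr => ?_
    rw [Set.uIcc_of_le hT] at hr
    rw [foldedPath_after hεs (by linarith [hr.1]) le_rfl]

end Fold

/-! ### Horizontal lifts -/

section Lift

/-- The horizontal curve starting at `(·, y₀, z₀)` with `x`-coordinate `X` and `y`-velocity `w`. -/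
noncomputable def horizontalLift (F : ℝ[X]) (X w : ℝ → ℝ) (y₀ z₀ : ℝ) (r : ℝ) : Fin 3 → ℝ :=
  ![X r, y₀ + ∫ u in (0 : ℝ)..r, w u, z₀ + ∫ u in (0 : ℝ)..r, F.eval (X u) * w u]

variable {F : ℝ[X]} {X w : ℝ → ℝ} {y₀ z₀ : ℝ}

theorem hasDerivAt_const_add_integral {w : ℝ → ℝ} (hw : Continuous w) (y₀ r : ℝ) :
    HasDerivAt (fun r => y₀ + ∫ u in (0 : ℝ)..r, w u) (w r) r :=
  (hw.integral_hasStrictDerivAt 0 r).hasDerivAt.const_add y₀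

theorem absolutelyContinuousOnInterval_const_add_integral {w : ℝ → ℝ} (hw : Continuous w)
    (y₀ a b : ℝ) :
    AbsolutelyContinuousOnInterval (fun r => y₀ + ∫ u in (0 : ℝ)..r, w u) a b := by
  refine ContDiffOn.absolutelyContinuousOnInterval (ContDiff.contDiffOn ?_)
  rw [contDiff_one_iff_deriv]
  refine ⟨fun r => (hasDerivAt_const_add_integral hw y₀ r).differentiableAt, ?_⟩
  rwa [funext fun r => (hasDerivAt_const_add_integral hw y₀ r).deriv]

theorem isHorizontal_horizontalLift {K : NNReal} (hX : LipschitzWith K X) (hw : Continuous w)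
    {T : ℝ} (hT : 0 ≤ T) : IsHorizontal F (horizontalLift F X w y₀ z₀) 0 T := by
  have hFw : Continuous fun u => F.eval (X u) * w u :=
    (F.continuous.comp hX.continuous).mul hw
  refine ⟨hT, fun i => ?_, Filter.Eventually.of_forall fun t => ?_⟩
  · fin_cases i
    · exact (hX.lipschitzOnWith (s := Set.uIcc 0 T)).absolutelyContinuousOnInterval
    · exact absolutelyContinuousOnInterval_const_add_integral hw y₀ 0 T
    · exact absolutelyContinuousOnInterval_const_add_integral hFw z₀ 0 T
  · exact (hasDerivAt_const_add_integral hFw z₀ t).deriv.trans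
      (congrArg _ (hasDerivAt_const_add_integral hw y₀ t).deriv.symm)

theorem length_horizontalLift (hw : Continuous w) (T : ℝ) :
    length (horizontalLift F X w y₀ z₀) 0 T = ∫ r in (0 : ℝ)..T, √(deriv X r ^ 2 + w r ^ 2) := by
  refine intervalIntegral.integral_congr fun r _ => ?_
  have h : deriv (fun s => horizontalLift F X w y₀ z₀ s 1) r = w r :=
    (hasDerivAt_const_add_integral hw y₀ r).deriv
  simp only [h]
  rfl

end Lift

/-! ### Length cost, local bounds and choice of scale -/

section Estimates

/-- Bounds the length cost of the correction added to the `y`-velocity of a unit-speed path. -/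
theorem sqrt_sq_add_sq_le {d g e : ℝ} (h : d ^ 2 + g ^ 2 = 1) :
    √(d ^ 2 + (g + e) ^ 2) ≤ 1 + |e| := by
  refine (Real.sqrt_le_left (by positivity)).2 ?_
  have hg : |g| ≤ 1 := (sq_le_one_iff_abs_le_one _).1 (by linarith [sq_nonneg d])
  have h1 : g * e ≤ |e| := (le_abs_self _).trans (by
    rw [abs_mul]
    exact mul_le_of_le_one_left (abs_nonneg e) hg)
  nlinarith [sq_abs e]

/-- For `f = F(x)` the linear bound, integrated over a window of width `2η`, gives a `z`-error
`O(η²)`; for `g = G(x)` the gap `1 - q` is the rate at which resting saves length. -/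
theorem exists_local_bounds {f g : ℝ → ℝ} {f' s : ℝ} (hf : HasDerivAt f f' s)
    (hg : ContinuousAt g s) (hgs : |g s| < 1) :
    ∃ C q η₀ : ℝ, 0 < C ∧ q < 1 ∧ 0 < η₀ ∧
      ∀ u ∈ Set.Icc s (s + η₀), |f u - f s| ≤ C * (u - s) ∧ |g u| ≤ q := by
  obtain ⟨C, hC, hfC⟩ := hf.isBigO_sub.exists_pos
  obtain ⟨q, hq, hq1⟩ := exists_between hgs
  have hev := hfC.bound.and (hg.abs.eventually_lt continuousAt_const hq)
  obtain ⟨ρ, hρ, hball⟩ := Metric.eventually_nhds_iff.1 hev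
  refine ⟨C, q, ρ / 2, hC, hq1, half_pos hρ, fun u hu => ?_⟩
  have hd : dist u s < ρ := by
    rw [Real.dist_eq, abs_of_nonneg (by linarith [hu.1])]
    linarith [hu.2]
  obtain ⟨h1, h2⟩ := hball hd
  simp only [Real.norm_eq_abs] at h1
  rw [abs_of_nonneg (by linarith [hu.1] : 0 ≤ u - s)] at h1
  exact ⟨h1, h2.le⟩

/-- A continuous function which is not constant on `[0, T]` correlates with its deviation from the
mean. -/
theorem exists_mean {f : ℝ → ℝ} (hf : Continuous f) {T : ℝ} (hT : 0 < T)
    (hne : ∀ m, ∃ r ∈ Set.Icc 0 T, f r ≠ m) :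
    ∃ m, ∫ r in (0 : ℝ)..T, (f r - m) = 0 ∧ 0 < ∫ r in (0 : ℝ)..T, f r * (f r - m) := by
  set m := (∫ r in (0 : ℝ)..T, f r) / T with hm
  have h0 : ∫ r in (0 : ℝ)..T, (f r - m) = 0 := by
    rw [intervalIntegral.integral_sub (hf.intervalIntegrable _ _) intervalIntegrable_const,
      intervalIntegral.integral_const, hm, smul_eq_mul, sub_zero, mul_div_cancel₀ _ hT.ne',
      sub_self]
  refine ⟨m, h0, ?_⟩
  obtain ⟨r, hr, hrm⟩ := hne m
  have hpos : 0 < ∫ r in (0 : ℝ)..T, (f r - m) ^ 2 :=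
    intervalIntegral.integral_pos hT (by fun_prop) (fun _ _ => sq_nonneg _)
      ⟨r, hr, by have := sub_ne_zero.2 hrm; positivity⟩
  have hsplit : ∫ r in (0 : ℝ)..T, f r * (f r - m) =
      (∫ r in (0 : ℝ)..T, (f r - m) ^ 2) + m * ∫ r in (0 : ℝ)..T, (f r - m) := by
    rw [← intervalIntegral.integral_const_mul, ← intervalIntegral.integral_add
      (Continuous.intervalIntegrable (by fun_prop) _ _)
      (Continuous.intervalIntegrable (by fun_prop) _ _)]
    exact intervalIntegral.integral_congr fun r _ => by ring
  rw [hsplit, h0]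
  simpa using hpos

/-- Both inequalities are strict at `η = 0`, hence hold nearby by continuity. -/
theorem exists_small {a A B k l : ℝ} (ha : 0 < a) (hk : 0 < k) (hl : 0 < l) :
    ∃ η, 0 < η ∧ η < a ∧ A * η ^ 2 < k ∧ B * η < l := by
  have h1 : ∀ᶠ η in nhds (0 : ℝ), A * η ^ 2 < k :=
    (Continuous.tendsto' (by fun_prop) 0 0 (by simp) : Filter.Tendsto (fun η : ℝ => A * η ^ 2) _
      (nhds 0)).eventually_lt_const hk
  have h2 : ∀ᶠ η in nhds (0 : ℝ), B * η < l :=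
    (Continuous.tendsto' (by fun_prop) 0 0 (by simp) : Filter.Tendsto (fun η : ℝ => B * η) _
      (nhds 0)).eventually_lt_const hl
  obtain ⟨η, hη, h1, h2⟩ := (Filter.Eventually.and (Ioo_mem_nhdsGT ha)
    ((h1.and h2).filter_mono nhdsWithin_le_nhds)).exists
  exact ⟨η, hη.1, hη.2, h1, h2⟩

end Estimates

/-! ### The shorter competitor and the cut time -/

variable {F : ℝ[X]} {c p : ℝ → Fin 3 → ℝ}

/-- Just after a transversal time, `x` sweeps out a nondegenerate interval, on which a nonconstant
polynomial cannot be constant. -/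
theorem IsGeodesic.exists_eval_ne (hc : IsGeodesic F c p) {s T : ℝ} (hsT : s < T)
    (hp : p s 0 ≠ 0) (hF : 0 < F.natDegree) (m : ℝ) :
    ∃ r ∈ Set.Icc s T, F.eval (c r 0) ≠ m := by
  by_contra! h
  obtain ⟨r, hr, hrs⟩ : ∃ r ∈ Set.Ioo s T, c r 0 ≠ c s 0 :=
    ((Filter.Eventually.and (Ioo_mem_nhdsGT hsT) (((hc.hasDerivAt_x s).eventually_ne
      hp (c := c s 0)).filter_mono (nhdsWithin_mono s fun r (hr : s < r) => hr.ne')))).exists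
  have hinf : (Set.uIcc (c s 0) (c r 0)).Infinite := by
    exact Set.Icc_infinite (inf_lt_sup.2 hrs.symm)
  have hFm : F = C m := by
    refine eq_of_infinite_eval_eq _ _ (hinf.mono fun u hu => ?_)
    obtain ⟨t, ht, rfl⟩ := intermediate_value_uIcc (hc.continuous_x.continuousOn) hu
    rw [Set.uIcc_of_le hr.1.le] at ht
    simpa using h t ⟨ht.1, ht.2.trans hr.2.le⟩
  rw [hFm, natDegree_C] at hF
  exact lt_irrefl _ hF

/-- If `F(x)` has period `τ`, then reflecting the arc of length `τ` before the time `s` keeps the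
endpoints, so that a geodesic which moves transversally at time `s` does not minimize past `s`. -/
theorem IsGeodesic.not_isLengthMinimizing (hc : IsGeodesic F c p) {τ s T : ℝ} (hτ : 0 < τ)
    (hτs : τ < s) (hsT : s < T) (hper : Function.Periodic (fun t => c t 0) (2 * τ))
    (hFper : Function.Periodic (fun t => F.eval (c t 0)) τ) (hp : p s 0 ≠ 0)
    (hF : 0 < F.natDegree) : ¬ IsLengthMinimizing F c 0 T := by
  set G := geodesicPolynomial F p with hG
  set x : ℝ → ℝ := fun t => c t 0
  have hX := hc.lipschitzWith_x
  have hT : 0 < T := by linarith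
  obtain ⟨ε, hε⟩ : ∃ ε, ε = s - τ := ⟨_, rfl⟩
  have hsε : s - ε = τ := by linarith
  have hεs : ε ≤ s := by linarith
  have hx : x (2 * s - ε) = x ε := by
    rw [← hper ε]
    congr 1
    linarith
  have hGper : Function.Periodic (fun t => G.eval (x t)) (s - ε) := fun t => by
    have h : F.eval (x (t + τ)) = F.eval (x t) := hFper t
    simp [hG, geodesicPolynomial, hsε, h]
  -- the folded path and its invariants
  have hX0 : Continuous (foldedPath x ε s 0) := (lipschitzWith_foldedPath hX ε s 0).continuous
  obtain ⟨f, hf⟩ : ∃ f : ℝ → ℝ, f = fun r => F.eval (foldedPath x ε s 0 r) := ⟨_, rfl⟩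
  obtain ⟨g, hg⟩ : ∃ g : ℝ → ℝ, g = fun r => G.eval (foldedPath x ε s 0 r) := ⟨_, rfl⟩
  have hfc : Continuous f := hf ▸ F.continuous.comp hX0
  have hgc : Continuous g := hg ▸ G.continuous.comp hX0
  have hg1 : ∀ r, |g r| ≤ 1 := fun r => by
    obtain ⟨u, hu⟩ := foldedPath_zero_mem_range hεs hx r
    rw [hg]
    simp only [hu]
    exact (sq_le_one_iff_abs_le_one _).1 (by linarith [hc.sq_add_sq u, sq_nonneg (p u 0)])
  have hint_g : ∫ r in (0 : ℝ)..T, g r = c T 1 - c 0 1 := by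
    rw [hg, integral_foldedPath_zero G.continuous hX hεs hx hGper (by linarith) hsT.le]
    exact intervalIntegral.integral_eq_sub_of_hasDerivAt (fun t _ => hc.hasDerivAt_y t)
      (G.continuous.comp hc.continuous_x |>.intervalIntegrable _ _)
  have hint_fg : ∫ r in (0 : ℝ)..T, f r * g r = c T 2 - c 0 2 := by
    have h1 := integral_foldedPath_zero (h := fun u => F.eval u * G.eval u)
      (F.continuous.mul G.continuous) hX hεs hx
      ((hsε.symm ▸ hFper).mul hGper) (by linarith) hsT.le
    rw [hf, hg, h1]
    exact intervalIntegral.integral_eq_sub_of_hasDerivAt (fun t _ => hc.hasDerivAt_z t)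
      (((F.continuous.mul G.continuous).comp hc.continuous_x).intervalIntegrable _ _)
  -- the correction `ψ`
  obtain ⟨m, hm0, hK⟩ := exists_mean hfc hT fun m => by
    obtain ⟨r, hr, hrm⟩ := hc.exists_eval_ne hsT hp hF m
    refine ⟨r, ⟨by linarith [hr.1], hr.2⟩, ?_⟩
    rw [hf]
    simp only [foldedPath_after hεs (by linarith [hr.1] : s + 0 ≤ r) le_rfl]
    exact hrm
  obtain ⟨ψ, hψ⟩ : ∃ ψ : ℝ → ℝ, ψ = fun r => f r - m := ⟨_, rfl⟩
  have hψc : Continuous ψ := hψ ▸ hfc.sub continuous_const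
  obtain ⟨K, hKdef⟩ : ∃ K, K = ∫ r in (0 : ℝ)..T, f r * ψ r := ⟨_, rfl⟩
  have hK0 : 0 < K := by rw [hKdef, hψ]; exact hK
  have hψ0 : ∫ r in (0 : ℝ)..T, ψ r = 0 := by rw [hψ]; exact hm0
  obtain ⟨M, hM0, hM⟩ : ∃ M, 0 < M ∧ ∀ r, |ψ r| ≤ M := by
    obtain ⟨R, hR⟩ := (hFper.isBounded_of_continuous hτ.ne'
      (F.continuous.comp hc.continuous_x)).subset_closedBall 0
    refine ⟨|R| + |m| + 1, by positivity, fun r => ?_⟩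
    obtain ⟨u, hu⟩ := foldedPath_zero_mem_range hεs hx r
    have h1 : |F.eval (x u)| ≤ R := by simpa using hR ⟨u, rfl⟩
    rw [hψ, hf]
    simp only [hu]
    linarith [abs_sub (F.eval (x u)) m, le_abs_self R]
  -- local bounds at the corner
  obtain ⟨C, q, η₀, hC, hq, hη₀, hloc⟩ := exists_local_bounds
    (f := fun t => F.eval (x t)) (g := fun t => G.eval (x t)) (s := s)
    ((F.hasDerivAt (x s)).comp s (hc.hasDerivAt_x s))
    (G.continuous.comp hc.continuous_x).continuousAt (by
      rw [← sq_lt_one_iff_abs_lt_one]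
      have := hc.sq_add_sq s
      have : 0 < p s 0 ^ 2 := by positivity
      linarith)
  -- The bounds on `η` keep the window inside `(ε, T)` and within reach of the local estimates. The
  -- constraint with `A` gives `|E₁| < K / 2`; the one with `B` makes the correction cost less than
  -- the gain `2(1 - q)η`.
  obtain ⟨η, hη, hηa, hη1, hη2⟩ := exists_small (a := min τ (min (T - s) η₀))
    (A := 4 * C * M) (k := K / 2) (B := T * (8 * C * M / K)) (l := (1 - q) * 2)
    (lt_min hτ (lt_min (by linarith) hη₀)) (by linarith) (by linarith)
  obtain ⟨hητ, hηT, hηη⟩ : η < τ ∧ η < T - s ∧ η < η₀ := by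
    simpa only [lt_min_iff] using hηa
  have hηε : η < s - ε := by linarith
  obtain ⟨X, hXd⟩ : ∃ X, X = foldedPath x ε s η := ⟨_, rfl⟩
  have hXL : LipschitzWith 2 X := hXd ▸ lipschitzWith_foldedPath hX ε s η
  have hFX : Continuous fun r => F.eval (X r) := F.continuous.comp hXL.continuous
  have hcorner : ∀ r ∈ Set.Icc (s - η) (s + η),
      |F.eval (X r) - f r| ≤ 2 * C * η ∧ |g r| ≤ q := fun r hr => by
    have hr' : |r - s| ≤ η := abs_le.2 ⟨by linarith [hr.1], by linarith [hr.2]⟩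
    have hεr : ε ≤ r := by linarith [hr.1]
    have h1 := (hloc (s + η) ⟨by linarith, by linarith⟩).1
    have h2 := hloc (s + |r - s|) ⟨by linarith [abs_nonneg (r - s)], by linarith⟩
    have h3 : foldedPath x ε s 0 r = x (s + |r - s|) := by
      rw [foldedPath_of_ge hεr, max_eq_left (abs_nonneg _)]
    rw [hXd, foldedPath_corner hεr hr', hf, hg]
    simp only [h3]
    refine ⟨?_, h2.2⟩
    have h4 := h2.1
    rw [add_sub_cancel_left] at h1 h4
    have h5 := abs_sub_le (F.eval (x (s + η))) (F.eval (x s)) (F.eval (x (s + |r - s|)))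
    rw [abs_sub_comm (F.eval (x s))] at h5
    have h6 : C * |r - s| ≤ C * η := by gcongr
    linarith
  have hoff : ∀ r, r ∉ Set.Icc (s - η) (s + η) → F.eval (X r) - f r = 0 := fun r hr => by
    rw [hXd, hf, foldedPath_eq_of_notMem hη.le hηε.le hr, sub_self]
  -- An error of at most `2Cη` times `N`, on a window of width `2η`.
  have hest : ∀ (φ : ℝ → ℝ) (N : ℝ), (∀ r, |φ r| ≤ N) → 0 ≤ N →
      |∫ r in (0 : ℝ)..T, (F.eval (X r) - f r) * φ r| ≤ 4 * C * N * η ^ 2 := fun φ N hφ hN => by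
    refine (abs_integral_le_of_support (K := 2 * C * η * N) (a := s - η) (b := s + η)
      (by linarith) (by linarith) (by linarith) (fun r hr => ?_) (fun r hr => ?_)).trans
      (le_of_eq (by ring))
    · rw [abs_mul]
      exact mul_le_mul (hcorner r hr).1 (hφ r) (abs_nonneg _) (by positivity)
    · rw [hoff r hr, zero_mul]
  obtain ⟨E₁, hE₁⟩ : ∃ E, E = ∫ r in (0 : ℝ)..T, (F.eval (X r) - f r) * ψ r := ⟨_, rfl⟩
  obtain ⟨E₂, hE₂⟩ : ∃ E, E = ∫ r in (0 : ℝ)..T, (F.eval (X r) - f r) * g r := ⟨_, rfl⟩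
  have hE₁le : |E₁| < K / 2 := hE₁ ▸ (hest ψ M hM hM0.le).trans_lt hη1
  have hE₂le : |E₂| ≤ 4 * C * 1 * η ^ 2 := hE₂ ▸ hest g 1 hg1 zero_le_one
  have hKE : K / 2 ≤ K + E₁ := by linarith [neg_abs_le E₁]
  -- Here `K + E₁ = ∫ F(X)ψ`, so this `l` makes the correction cancel the `z`-error `E₂`.
  obtain ⟨l, hl⟩ : ∃ l, l = -E₂ / (K + E₁) := ⟨_, rfl⟩
  have hlE : l * (K + E₁) = -E₂ := by
    rw [hl]
    exact div_mul_cancel₀ _ (by linarith)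
  have hlle : |l| ≤ 8 * C * η ^ 2 / K := by
    rw [hl, abs_div, abs_neg, abs_of_pos (by linarith : 0 < K + E₁),
      div_le_div_iff₀ (by linarith) hK0]
    have h1 : |E₂| * K ≤ 4 * C * 1 * η ^ 2 * K := by gcongr
    have h2 : 8 * C * η ^ 2 * (K / 2) ≤ 8 * C * η ^ 2 * (K + E₁) := by gcongr
    linarith
  -- The velocity uses `g` from the uncut fold, so cutting the corner does not disturb `y`; neither
  -- does `ψ`, whose integral is zero.
  obtain ⟨w, hw⟩ : ∃ w : ℝ → ℝ, w = fun r => g r + l * ψ r := ⟨_, rfl⟩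
  have hwc : Continuous w := hw ▸ hgc.add (continuous_const.mul hψc)
  have hint : ∀ {h : ℝ → ℝ}, Continuous h → IntervalIntegrable h volume 0 T :=
    fun h => h.intervalIntegrable _ _
  have hint_w : ∫ r in (0 : ℝ)..T, w r = c T 1 - c 0 1 := by
    have h1 : Continuous fun r => l * ψ r := by fun_prop
    rw [hw, intervalIntegral.integral_add (hint hgc) (hint h1),
      intervalIntegral.integral_const_mul, hψ0, hint_g, mul_zero, add_zero]
  have hint_Fw : ∫ r in (0 : ℝ)..T, F.eval (X r) * w r = c T 2 - c 0 2 := by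
    have h1 : ∀ r, F.eval (X r) * w r = f r * g r + (F.eval (X r) - f r) * g r +
        l * (f r * ψ r + (F.eval (X r) - f r) * ψ r) := fun r => by
      rw [hw]
      ring
    have k₁ : Continuous fun r => f r * g r := by fun_prop
    have k₂ : Continuous fun r => (F.eval (X r) - f r) * g r := by fun_prop
    have k₃ : Continuous fun r => f r * ψ r := by fun_prop
    have k₄ : Continuous fun r => (F.eval (X r) - f r) * ψ r := by fun_prop
    simp only [h1]
    rw [intervalIntegral.integral_add ((hint k₁).add (hint k₂))
      (((hint k₃).add (hint k₄)).const_mul l), intervalIntegral.integral_const_mul,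
      intervalIntegral.integral_add (hint k₁) (hint k₂),
      intervalIntegral.integral_add (hint k₃) (hint k₄),
      ← hE₁, ← hE₂, ← hKdef, hlE, hint_fg]
    ring
  -- the length of the competitor
  have hlen : ∫ r in (0 : ℝ)..T, √(deriv X r ^ 2 + w r ^ 2) ≤
      (1 + |l| * M) * T - (1 - q) * ((s + η) - (s - η)) := by
    refine integral_le_of_drop (by linarith) (by linarith) (by linarith)
      (fun r => Real.sqrt_nonneg _) ?_
    have hne : ∀ a : ℝ, ∀ᵐ r : ℝ, r ≠ a := fun a => by simp [ae_iff]
    filter_upwards [hne ε, hne (s - η), hne (s + η)] with r h1 h2 h3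
    have hlψ : |l * ψ r| ≤ |l| * M := by
      rw [abs_mul]
      gcongr
      exact hM r
    have hwr : w r = g r + l * ψ r := by rw [hw]
    rw [hwr]
    rcases exists_hasDerivAt_foldedPath hc.hasDerivAt_x hη hηε hx h1 h2 h3 with
      ⟨hr, hd⟩ | ⟨hr, u, hu, hd⟩
    -- In the window `X` rests, so the speed is just `|w| ≤ q + |l|M`.
    · rw [hXd, hd.deriv, Set.indicator_of_mem hr, zero_pow two_ne_zero, zero_add,
        Real.sqrt_sq_eq_abs]
      linarith [abs_add_le (g r) (l * ψ r), (hcorner r hr).2]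
    · have hsq : deriv X r ^ 2 + g r ^ 2 = 1 := by
        have h5 : deriv X r ^ 2 = p u 0 ^ 2 := by
          rcases hd with hd | hd
          · rw [hXd, hd.deriv]
          · rw [hXd, hd.deriv, neg_sq]
        have h6 : g r = G.eval (x u) := by
          rw [hg]
          exact congrArg (fun y => G.eval y) hu
        rw [h5, h6]
        exact hc.sq_add_sq u
      rw [Set.indicator_of_notMem hr]
      linarith [sqrt_sq_add_sq_le (e := l * ψ r) hsq]
  have hshort : (1 + |l| * M) * T - (1 - q) * ((s + η) - (s - η)) < T := by
    -- Cost of order `η²` against a gain `2(1 - q)η`.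
    have h1 : |l| * M * T ≤ 8 * C * η ^ 2 / K * M * T := by gcongr
    have h2 : T * (8 * C * M / K) * η * η < (1 - q) * 2 * η := by gcongr
    have h3 : 8 * C * η ^ 2 / K * M * T = T * (8 * C * M / K) * η * η := by ring
    linarith
  intro hmin
  have h := hmin.2 (horizontalLift F X w (c 0 1) (c 0 2)) 0 T
    (isHorizontal_horizontalLift hXL hwc hT.le) ?_ ?_
  · rw [hc.length_eq, length_horizontalLift hwc] at h
    linarith
  · ext i
    fin_cases i
    · change X 0 = x 0
      rw [hXd, foldedPath_of_le hηε.le hεs hx (by linarith)]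
    · simp [horizontalLift]
    · simp [horizontalLift]
  · ext i
    fin_cases i
    · change X T = x T
      rw [hXd, foldedPath_after hεs (by linarith) hη.le]
    · change c 0 1 + ∫ r in (0 : ℝ)..T, w r = c T 1
      rw [hint_w, add_sub_cancel]
    · change c 0 2 + ∫ r in (0 : ℝ)..T, F.eval (X r) * w r = c T 2
      rw [hint_Fw, add_sub_cancel]

theorem natDegree_pos_of_geodesicPolynomial (h : 0 < (geodesicPolynomial F p).natDegree) :
    0 < F.natDegree := by
  by_contra! h0
  rw [eq_C_of_natDegree_le_zero h0] at h
  simp [geodesicPolynomial, ← C_mul, ← C_add, -map_mul, -map_add] at h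

theorem IsXPeriodicGeodesic.cutTime_le {L τ : ℝ} (hc : IsXPeriodicGeodesic F c p L)
    (hτ : 0 < τ) (hper : Function.Periodic (fun t => c t 0) (2 * τ))
    (hFper : Function.Periodic (fun t => F.eval (c t 0)) τ) :
    cutTime F c ≤ ENNReal.ofReal τ := by
  refine iSup₂_le fun T hT => ENNReal.ofReal_le_ofReal ?_
  by_contra! hlt
  obtain ⟨s, hs, hp⟩ := hc.exists_momentum_x_ne_zero hlt
  exact hc.geodesic.not_isLengthMinimizing hτ hs.1 hs.2 hper hFper hp
    (natDegree_pos_of_geodesicPolynomial hc.not_line) hT.2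

end MagneticSpace

theorem mainTheorem4 (F : Polynomial ℝ) (c p : ℝ → Fin 3 → ℝ) (L : ℝ)
    (hc : MagneticSpace.IsXPeriodicGeodesic F c p L) :
    MagneticSpace.cutTime F c ≤ ENNReal.ofReal L ∧
      ∀ A B : ℝ, MagneticSpace.IsHillIntervalOf F c p A B →
        (∀ x : ℝ, F.eval (-x) = F.eval x) → (0 : ℝ) ∈ Set.Icc A B →
          MagneticSpace.cutTime F c ≤ ENNReal.ofReal (L / 2) := by
  refine ⟨hc.cutTime_le hc.pos (hc.periodic.nat_mul 2) fun t => ?_, fun A B h hF h0 => ?_⟩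
  · exact congrArg (fun u => F.eval u) (hc.periodic t)
  · refine hc.cutTime_le (half_pos hc.pos) ?_ fun t => ?_
    · rw [mul_div_cancel₀ L two_ne_zero]
      exact hc.periodic
    · have h1 : c (t + L / 2) 0 = -c t 0 := hc.antiperiodic_half h hF h0 t
      change F.eval (c (t + L / 2) 0) = F.eval (c t 0)
      rw [h1, hF]
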